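/- Consider a storage network with $n$ nodes in which, in every time slot, exactly one node fails and is replaced by a newcomer that contacts $d$ helpers among the $n-1$ surviving nodes. A dynamic helper selection (DHS) scheme chooses, in each time slot $\tau$, the helper set as a function $D_\tau(F_1,\dots,F_\tau)$ of all failures so far. Every node stores an amount $\alpha\ge 0$, every helper sends an amount $\beta\ge 0$ to the newcomer, and at every time any $k$ active nodes must suffice to reconstruct a file of size $\mathcal M\ge 0$. A DHS scheme $A$ can protect a file of size $\mathcal M$ if there is a functional-repair code over some finite alphabet (with $\mathcal M,\alpha,\beta$ measured in alphabet symbols) that uses the helper sets of $A$ and from which, for every failure pattern and at every time, the file is a function of the contents of any $k$ active nodes. It satisfies the min-cut condition for $\mathcal M$ if $\min_{G\in\mathcal G_A}\min_{t\in \mathrm{DC}(G)}\mathrm{mincut}_G(s,t)\ge\mathcal M$. Here $\mathcal G_A$ is the set of information flow graphs of $A$: each storage node (initial node or newcomer) $x$ is an edge $x_{\mathrm{in}}\to x_{\mathrm{out}}$ of capacity $\alpha$, the source $s$ is joined to the inputs of the initial nodes by edges of infinite capacity, the outputs of the active helpers are joined to the input of a newcomer by edges of capacity $\beta$, and each data collector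 in $\mathrm{DC}(G)$ is joined to the outputs of one choice of $k$ active nodes by edges of infinite capacity. Let $(n,k,d)=(4,3,2)$ and $\alpha=\beta$. Then for every $\mathcal M>2\alpha$, no DHS scheme can protect a file of size $\mathcal M$, and no DHS scheme satisfies the min-cut condition for $\mathcal M$. For these parameters, Hollmann's upper bound $\frac{nd\alpha}{d+1}$ on the file size (for $k=n-1$ and $\alpha=\beta$) equals $\frac{8\alpha}{3}$. If $\alpha>0$, then $2\alpha<\frac{8\alpha}{3}$, and Hollmann's bound is not tight: $\frac{8\alpha}{3}$ is neither the supremum of the file sizes that DHS schemes can protect, nor the supremum of the file sizes for which DHS schemes satisfy the min-cut condition. -/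

import Mathlib

open scoped NNReal ENNReal

noncomputable section

namespace Storage

/-- A dynamic helper selection scheme for `n` nodes and `d` helpers: in time slot `τ` (slots are
counted from `0`) the helper set is a function of all failed nodes of the slots `0, …, τ`. It
consists of `d` nodes other than the node that fails in slot `τ`. -/
structure DHS (n d : ℕ) where
  helpers : (τ : ℕ) → (Fin (τ + 1) → Fin n) → Finset (Fin n)
  card_helpers : ∀ τ h, (helpers τ h).card = d
  failed_notMem : ∀ τ h, h (Fin.last τ) ∉ helpers τ h

/-- The failures in slots `0, …, τ` of the failure pattern `F`. -/
def history {n : ℕ} (F : ℕ → Fin n) (τ : ℕ) : Fin (τ + 1) → Fin n := fun j => F j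

/-! ### Minimum cuts of finite capacitated directed graphs -/

/-- The minimum cut value separating `s` from `t`, where `c x y` is the capacity of the edge from
`x` to `y` (and `0` if there is no such edge). -/
def minCut {V : Type*} [Fintype V] [DecidableEq V] (c : V → V → ℝ≥0∞) (s t : V) : ℝ≥0∞ :=
  ⨅ (U : Finset V) (_ : s ∈ U) (_ : t ∉ U), ∑ x ∈ U, ∑ y ∈ Uᶜ, c x y

/-! ### Information flow graphs -/

/-- The storage nodes of the information flow graph after `T` repairs. -/
inductive Version (n T : ℕ) where
  /-- the initial version of the physical node `i` -/
  | init (i : Fin n)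
  /-- the newcomer of time slot `τ` -/
  | newcomer (τ : Fin T)
  deriving DecidableEq, Fintype

/-- The vertices of the information flow graph after `T` repairs. There is one data collector for
every choice of `k` out of the `n` active nodes. -/
inductive Vertex (n k T : ℕ) where
  | source
  | inp (x : Version n T)
  | out (x : Version n T)
  | collector (S : {S : Finset (Fin n) // S.card = k})
  deriving DecidableEq, Fintype

/-- The physical node that a storage node of the graph is a version of. -/
def Version.node {n T : ℕ} (F : ℕ → Fin n) : Version n T → Fin n
  | .init i => i
  | .newcomer τ => F τ

/-- The storage node is active just before the failure of slot `t`, i.e. it has already been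
created and has not failed in any slot before `t`. -/
def Version.Active {n T : ℕ} (F : ℕ → Fin n) (t : ℕ) : Version n T → Prop
  | .init i => ∀ u < t, F u ≠ i
  | .newcomer τ => (τ : ℕ) < t ∧ ∀ u < t, (τ : ℕ) < u → F u ≠ F τ

open Classical in
/-- The edge capacities of the information flow graph of the scheme `A` after the first `T`
failures of the failure pattern `F`. -/
def DHS.ifg {n d : ℕ} (A : DHS n d) (k : ℕ) (α β : ℝ≥0) (F : ℕ → Fin n) (T : ℕ) :
    Vertex n k T → Vertex n k T → ℝ≥0∞
  | .source, .inp (.init _) => ⊤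
  | .inp x, .out y => if x = y then (α : ℝ≥0∞) else 0
  | .out x, .inp (.newcomer τ) =>
      if x.Active F τ ∧ x.node F ∈ A.helpers τ (history F τ) then (β : ℝ≥0∞) else 0
  | .out x, .collector S => if x.Active F T ∧ x.node F ∈ S.1 then ⊤ else 0
  | _, _ => 0

/-- The min-cut condition for the file size `M`: in every information flow graph of the scheme,
every data collector is separated from the source by a minimum cut of value at least `M`. -/
def DHS.CutCondition {n d : ℕ} (A : DHS n d) (k : ℕ) (α β M : ℝ≥0) : Prop :=
  (M : ℝ≥0∞) ≤ ⨅ (F : ℕ → Fin n) (T : ℕ) (S : {S : Finset (Fin n) // S.card = k}),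
    minCut (A.ifg k α β F T) .source (.collector S)

/-! ### Codes with functional repair -/

/-- A regenerating code with functional repair that uses the helper selection scheme `A`. In every
slot each helper sends a function of its own content, and the newcomer stores a function of the
messages that it receives; these functions may depend on the failure history. -/
structure RegeneratingCode {n d : ℕ} (A : DHS n d) (File Content Message : Type) where
  encode : File → Fin n → Content
  send : (τ : ℕ) → (Fin (τ + 1) → Fin n) → Fin n → Content → Message
  repair : (τ : ℕ) → (h : Fin (τ + 1) → Fin n) → (A.helpers τ h → Message) → Content

/-- The contents of the `n` active nodes after the first `T` repairs under the failure pattern `F`,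
if the file is `w`. -/
def RegeneratingCode.contents {n d : ℕ} {A : DHS n d} {File Content Message : Type}
    (C : RegeneratingCode A File Content Message) (F : ℕ → Fin n) (w : File) :
    ℕ → Fin n → Content
  | 0 => C.encode w
  | τ + 1 => Function.update (C.contents F w τ) (F τ)
      (C.repair τ (history F τ) fun j => C.send τ (history F τ) j (C.contents F w τ j))

/-- The reconstruction requirement: at any time and for every failure pattern, the file is a
function of the contents of any `k` active nodes. -/
def RegeneratingCode.Reconstructs {n d : ℕ} {A : DHS n d} {File Content Message : Type}
    (C : RegeneratingCode A File Content Message) (k : ℕ) : Prop :=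
  ∀ (F : ℕ → Fin n) (T : ℕ) (S : Finset (Fin n)), S.card = k →
    ∃ decode : (S → Content) → File, ∀ w, decode (fun i => C.contents F w T i) = w

/-- The scheme `A` can protect a file of size `M` with storage `α` per node and traffic `β` per
helper, all measured in symbols of an alphabet with `q` elements. -/
def DHS.Protects {n d : ℕ} (A : DHS n d) (k : ℕ) (α β M : ℝ≥0) : Prop :=
  ∃ q : ℕ, 2 ≤ q ∧ ∃ (File Content Message : Type)
    (_ : Fintype File) (_ : Fintype Content) (_ : Fintype Message)
    (C : RegeneratingCode A File Content Message),
    C.Reconstructs k ∧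
    (M : ℝ) ≤ Real.logb q (Fintype.card File) ∧
    Real.logb q (Fintype.card Content) ≤ α ∧
    Real.logb q (Fintype.card Message) ≤ β

/-- Hollmann's upper bound `n d α / (d + 1)` on the file size for `k = n - 1` and `α = β`. -/
def hollmannBound (n d : ℕ) (α : ℝ≥0) : ℝ≥0 := n * d * α / (d + 1)

end Storage

end

namespace Storage

/-! After a single repair, the newcomer and its `d` helpers are `d + 1` active nodes, but the
newcomer's content is a function of the helpers' contents. If any `d + 1` nodes must reconstruct,
then `d` nodes already determine the file, so its size is at most `d * α`, whatever `n`, `β` and the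
helper choice. `DHS.Protects.le` makes this precise by counting contents, `DHS.CutCondition.le` by a
cut through the `d` helpers. With `k = 3 = d + 1` the bound is `2 * α`, below Hollmann's `8 * α /
3`. -/

/-- A failed node together with the `d` helpers of its newcomer. -/
def DHS.repairGroup {n d : ℕ} (A : DHS n d) (F : ℕ → Fin n) (τ : ℕ) : Finset (Fin n) :=
  insert (F τ) (A.helpers τ (history F τ))

theorem DHS.card_repairGroup {n d : ℕ} (A : DHS n d) (F : ℕ → Fin n) (τ : ℕ) :
    (A.repairGroup F τ).card = d + 1 := by
  have h : F τ ∉ A.helpers τ (history F τ) := by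
    simpa [history] using A.failed_notMem τ (history F τ)
  rw [DHS.repairGroup, Finset.card_insert_of_notMem h, A.card_helpers]

/-- A repair group holds no more information than the `d` helpers in it. -/
theorem RegeneratingCode.card_file_le {n d : ℕ} {A : DHS n d} {File Content Message : Type}
    [Fintype File] [Fintype Content] (C : RegeneratingCode A File Content Message)
    (hC : C.Reconstructs (d + 1)) (f : Fin n) :
    Fintype.card File ≤ Fintype.card Content ^ d := by
  -- Only the failure in slot `0` matters, so a constant pattern suffices.
  set F : ℕ → Fin n := fun _ => f
  obtain ⟨decode, hdec⟩ := hC F 1 (A.repairGroup F 0) (A.card_repairGroup F 0)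
  let H := A.helpers 0 (history F 0)
  -- The decoder of the repair group sees only data computed from the helpers' initial contents, so
  -- these separate files.
  have hinj : Function.Injective fun (w : File) (j : H) => C.encode w j := by
    intro w w' hw
    have hj : ∀ j ∈ H, C.encode w j = C.encode w' j := fun j hj => congrFun hw ⟨j, hj⟩
    rw [← hdec w, ← hdec w']
    congr 1
    funext ⟨i, hi⟩
    simp only [RegeneratingCode.contents]
    by_cases hif : i = F 0
    · subst hif
      rw [Function.update_self, Function.update_self]
      congr 1
      funext j
      rw [hj j j.2]
    · rw [Function.update_of_ne hif, Function.update_of_ne hif]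
      exact hj i (Finset.mem_of_mem_insert_of_ne hi hif)
  simpa [H, A.card_helpers] using Fintype.card_le_of_injective _ hinj

/-- If any `d + 1` nodes suffice for reconstruction, the file size is at most `d * α`. -/
theorem DHS.Protects.le {n d : ℕ} {A : DHS n d} {α β M : ℝ≥0}
    (h : A.Protects (d + 1) α β M) (f : Fin n) : M ≤ d * α := by
  obtain ⟨q, hq, File, Content, Message, _, _, _, C, hC, hM, hα, -⟩ := h
  have hq' : (1 : ℝ) < q := by exact_mod_cast hq
  rw [← NNReal.coe_le_coe]
  push_cast
  refine hM.trans ?_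
  -- An empty file type has `logb q 0 = 0` by convention; monotonicity of `logb` needs a positive
  -- argument.
  rcases Nat.eq_zero_or_pos (Fintype.card File) with h0 | h0
  · rw [h0]
    simp only [Nat.cast_zero, Real.logb_zero]
    positivity
  · calc Real.logb q (Fintype.card File)
        ≤ Real.logb q ((Fintype.card Content : ℝ) ^ d) :=
          Real.logb_le_logb_of_le hq' (by exact_mod_cast h0) (by exact_mod_cast C.card_file_le hC f)
      _ = d * Real.logb q (Fintype.card Content) := Real.logb_pow ..
      _ ≤ d * α := by gcongr

/-- A cut whose edges of nonzero capacity form a family of edges of capacity at most `α`. -/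
theorem minCut_le_card_mul {V ι : Type*} [Fintype V] [DecidableEq V] {c : V → V → ℝ≥0∞} {s t : V}
    {α : ℝ≥0∞} (U : Finset V) (hs : s ∈ U) (ht : t ∉ U) (H : Finset ι) (e e' : ι → V)
    (h : ∀ x ∈ U, ∀ y ∉ U, c x y ≠ 0 → ∃ a ∈ H, x = e a ∧ y = e' a ∧ c x y ≤ α) :
    minCut c s t ≤ H.card * α := by
  -- Bounding by a sum of indicators over `H` avoids requiring the edge family to be injective.
  have hedge : ∀ p ∈ U ×ˢ Uᶜ, c p.1 p.2 ≤ ∑ a ∈ H, if p = (e a, e' a) then α else 0 := by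
    rintro ⟨x, y⟩ hp
    rw [Finset.mem_product, Finset.mem_compl] at hp
    by_cases h0 : c x y = 0
    · simp [h0]
    · obtain ⟨a, ha, rfl, rfl, hle⟩ := h x hp.1 y hp.2 h0
      refine le_trans ?_ (Finset.single_le_sum (fun _ _ => zero_le) ha)
      simpa using hle
  calc minCut c s t ≤ ∑ x ∈ U, ∑ y ∈ Uᶜ, c x y := iInf₂_le_of_le U hs (iInf_le _ ht)
    _ = ∑ p ∈ U ×ˢ Uᶜ, c p.1 p.2 := (Finset.sum_product' ..).symm
    _ ≤ ∑ p ∈ U ×ˢ Uᶜ, ∑ a ∈ H, if p = (e a, e' a) then α else 0 := Finset.sum_le_sum hedge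
    _ = ∑ a ∈ H, ∑ p ∈ U ×ˢ Uᶜ, if p = (e a, e' a) then α else 0 := Finset.sum_comm
    _ ≤ ∑ _a ∈ H, α := Finset.sum_le_sum fun a _ => by
        rw [Finset.sum_ite_eq']
        split_ifs <;> simp
    _ = H.card * α := by rw [Finset.sum_const, nsmul_eq_mul]

theorem Version.eq_init_of_ne_newcomer {n : ℕ} {v : Version n 1} (h : v ≠ .newcomer 0) :
    ∃ i, v = .init i := by
  rcases v with i | τ
  · exact ⟨i, rfl⟩
  · exact absurd (by rw [Subsingleton.elim τ 0]) h

/-- The data collector of the first repair group is separated from the source by the edges inside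
the `d` helpers. -/
theorem DHS.minCut_repairGroup_le {n d : ℕ} (A : DHS n d) (α β : ℝ≥0) (F : ℕ → Fin n) :
    minCut (A.ifg (d + 1) α β F 1) .source
      (.collector ⟨A.repairGroup F 0, A.card_repairGroup F 0⟩) ≤ d * α := by
  -- The sink side of the cut. All `β`-edges into the newcomer start at helper outputs, hence stay
  -- inside `W`; only the helpers' in-out edges enter it.
  let W : Finset (Vertex n (d + 1) 1) :=
    {.collector ⟨A.repairGroup F 0, A.card_repairGroup F 0⟩, .inp (.newcomer 0),
      .out (.newcomer 0)} ∪ (A.helpers 0 (history F 0)).image fun a => .out (.init a)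
  have hW : ∀ y, y ∈ W ↔ (y = .collector ⟨A.repairGroup F 0, A.card_repairGroup F 0⟩ ∨
      y = .inp (.newcomer 0) ∨ y = .out (.newcomer 0)) ∨
      ∃ a ∈ A.helpers 0 (history F 0), .out (.init a) = y := by
    intro y
    simp only [W, Finset.mem_union, Finset.mem_insert, Finset.mem_singleton, Finset.mem_image]
  refine (minCut_le_card_mul (α := α) Wᶜ (by simp [hW]) (by simp [hW]) (A.helpers 0 (history F 0))
    (fun a => .inp (.init a)) (fun a => .out (.init a)) fun x hx y hy hne => ?_).trans_eq
      (by rw [A.card_helpers])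
  rw [Finset.mem_compl, hW] at hx
  rw [Finset.mem_compl, not_not, hW] at hy
  push Not at hx
  obtain ⟨⟨-, hxi, hxo⟩, hxH⟩ := hx
  rcases hy with (rfl | rfl | rfl) | ⟨a, ha, rfl⟩
  · rcases x with _ | x | x | S
    · simp [DHS.ifg] at hne
    · simp [DHS.ifg] at hne
    · obtain ⟨i, rfl⟩ := Version.eq_init_of_ne_newcomer (v := x) (by rintro rfl; exact hxo rfl)
      have hi : i ∉ A.helpers 0 (history F 0) := fun h => hxH i h rfl
      -- The failed node lies in the repair group, but its initial version is no longer active, so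
      -- it has no edge to the collector.
      have : ¬ ((Version.init i : Version n 1).Active F 1 ∧ i ∈ A.repairGroup F 0) := by
        rintro ⟨h1, h2⟩
        exact hi (Finset.mem_of_mem_insert_of_ne h2 (h1 0 one_pos).symm)
      simp [DHS.ifg, Version.node, this] at hne
    · simp [DHS.ifg] at hne
  · rcases x with _ | x | x | S
    · simp [DHS.ifg] at hne
    · simp [DHS.ifg] at hne
    · obtain ⟨i, rfl⟩ := Version.eq_init_of_ne_newcomer (v := x) (by rintro rfl; exact hxo rfl)
      have hi : i ∉ A.helpers 0 (history F 0) := fun h => hxH i h rfl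
      simp [DHS.ifg, Version.node, hi] at hne
    · simp [DHS.ifg] at hne
  · rcases x with _ | x | x | S
    · simp [DHS.ifg] at hne
    · have : x ≠ .newcomer 0 := by rintro rfl; exact hxi rfl
      simp [DHS.ifg, this] at hne
    · simp [DHS.ifg] at hne
    · simp [DHS.ifg] at hne
  -- The only heads reached by crossing edges of nonzero capacity: the outputs of the helpers.
  · rcases x with _ | x | x | S
    · simp [DHS.ifg] at hne
    · by_cases hxa : x = .init a
      · subst hxa
        exact ⟨a, ha, rfl, rfl, by simp [DHS.ifg]⟩
      · simp [DHS.ifg, hxa] at hne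
    · simp [DHS.ifg] at hne
    · simp [DHS.ifg] at hne

/-- If any `d + 1` nodes suffice for reconstruction, the min-cut condition fails above `d * α`. -/
theorem DHS.CutCondition.le {n d : ℕ} {A : DHS n d} {α β M : ℝ≥0}
    (h : A.CutCondition (d + 1) α β M) (f : Fin n) : M ≤ d * α := by
  let F : ℕ → Fin n := fun _ => f
  have h' : (M : ℝ≥0∞) ≤ d * α :=
    (h.trans (iInf_le_of_le F (iInf_le_of_le 1 (iInf_le _ _)))).trans
      (A.minCut_repairGroup_le α β F)
  exact_mod_cast h'

end Storage

theorem mainTheorem11 (α β : ℝ≥0) (hαβ : α = β) :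
    (∀ (A : Storage.DHS 4 2) (M : ℝ≥0), 2 * α < M →
      ¬ A.Protects 3 α β M ∧ ¬ A.CutCondition 3 α β M) ∧
    Storage.hollmannBound 4 2 α = 8 * α / 3 ∧
    (0 < α →
      2 * α < Storage.hollmannBound 4 2 α ∧
      ¬ IsLUB {M : ℝ≥0 | ∃ A : Storage.DHS 4 2, A.Protects 3 α β M}
          (Storage.hollmannBound 4 2 α) ∧
      ¬ IsLUB {M : ℝ≥0 | ∃ A : Storage.DHS 4 2, A.CutCondition 3 α β M}
          (Storage.hollmannBound 4 2 α)) := by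
  have hP : ∀ (A : Storage.DHS 4 2) (M : ℝ≥0), A.Protects 3 α β M → M ≤ 2 * α :=
    fun A M h => by simpa using Storage.DHS.Protects.le (d := 2) h 0
  have hC : ∀ (A : Storage.DHS 4 2) (M : ℝ≥0), A.CutCondition 3 α β M → M ≤ 2 * α :=
    fun A M h => by simpa using Storage.DHS.CutCondition.le (d := 2) h 0
  have hB : Storage.hollmannBound 4 2 α = 8 * α / 3 := by
    simp only [Storage.hollmannBound]
    norm_num
  refine ⟨fun A M hM => ⟨fun h => (hP A M h).not_gt hM, fun h => (hC A M h).not_gt hM⟩, hB,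
    fun hα => ?_⟩
  have hlt : 2 * α < Storage.hollmannBound 4 2 α := by
    rw [hB, ← NNReal.coe_lt_coe]
    have : (0 : ℝ) < α := hα
    push_cast
    linarith
  -- `2 * α` is an upper bound of either set, so a least upper bound cannot exceed it.
  exact ⟨hlt, fun h => (h.2 fun M ⟨A, hA⟩ => hP A M hA).not_gt hlt,
    fun h => (h.2 fun M ⟨A, hA⟩ => hC A M hA).not_gt hlt⟩
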